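/- Let $q$ be a complex number with $|q|<1$, and write $(q;q)_n=\prod_{j=1}^{n}(1-q^j)$ and $(q;q)_\infty=\prod_{j=1}^{\infty}(1-q^j)$. Then the infinite product $(q;q)_\infty$ converges and is nonzero, both series below converge absolutely, and $$\sum_{n\ge 0}\frac{q^{n^2+n}}{(q;q)_{2n+1}}=\frac{1}{(q;q)_\infty}\sum_{k\in\mathbb Z}\left(q^{15k^2-4k}-q^{15k^2+14k+3}\right).$$ (For $q=0$ the convention $0^0=1$ is used.) -/

import Mathlib

/-- The finite `q`-shifted factorial `(x; q)_n = ∏_{j=0}^{n-1} (1 - q^j x)`. -/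
def qPoch (x q : ℂ) (n : ℕ) : ℂ := ∏ j ∈ Finset.range n, (1 - q ^ j * x)

/-- The infinite `q`-shifted factorial `(x; q)_∞ = ∏_{j ≥ 0} (1 - q^j x)`. -/
noncomputable def qPochInf (x q : ℂ) : ℂ := ∏' j : ℕ, (1 - q ^ j * x)

/-! This is a Bailey pair argument. The finite identity `tsum_oddTerm` expands 1/(q;q)_{2n+1} as an
alternating sum over k of products 1/((q;q)_{n-r} (q;q)_{n+r+1}) with r = 3k and r = 3k+1. It
follows by induction from the q-Pascal rule, whose extra terms cancel under an involution of k.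
Substituting it and exchanging the two sums, which converge absolutely together, leaves for each r
the sum over n of q^(n²+n)/((q;q)_{n-r} (q;q)_{n+r+1}). By the Durfee rectangle identity
`durfeeSum_eq` this equals q^(r²+r)/(q;q)_∞, and the exponents add up to 15k²+4k and 15k²+14k+3. -/

open Filter Topology

/-- The reciprocal `1 / (q; q)_m`, extended by zero to negative integers `m`. -/
noncomputable def invPoch (q : ℂ) (m : ℤ) : ℂ := if m < 0 then 0 else 1 / qPoch q q m.toNat

/-! ### The infinite product and reciprocal factorials at integer indices -/

section Basic

variable {q : ℂ}

theorem one_sub_pow_mul_self_ne_zero (hq : ‖q‖ < 1) (j : ℕ) : 1 - q ^ j * q ≠ 0 := by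
  intro h
  have h1 : ‖q ^ (j + 1)‖ < 1 := by
    rw [norm_pow]
    exact pow_lt_one₀ (norm_nonneg _) hq (Nat.succ_ne_zero j)
  rw [pow_succ, ← sub_eq_zero.mp h, norm_one] at h1
  exact lt_irrefl _ h1

theorem summable_norm_neg_pow_mul_self (hq : ‖q‖ < 1) :
    Summable fun j : ℕ => ‖-(q ^ j * q)‖ := by
  simp only [norm_neg, norm_mul, norm_pow]
  exact (summable_geometric_of_lt_one (norm_nonneg _) hq).mul_right _

theorem multipliable_one_sub_pow_mul_self (hq : ‖q‖ < 1) :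
    Multipliable fun j : ℕ => 1 - q ^ j * q := by
  simpa only [sub_eq_add_neg] using
    multipliable_one_add_of_summable (summable_norm_neg_pow_mul_self hq)

theorem qPochInf_self_ne_zero (hq : ‖q‖ < 1) : qPochInf q q ≠ 0 := by
  have h := tprod_one_add_ne_zero_of_summable (f := fun j : ℕ => -(q ^ j * q))
    (fun j => by simpa only [sub_eq_add_neg] using one_sub_pow_mul_self_ne_zero hq j)
    (summable_norm_neg_pow_mul_self hq)
  simpa only [qPochInf, sub_eq_add_neg] using h

theorem tendsto_one_div_qPoch (hq : ‖q‖ < 1) :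
    Tendsto (fun n : ℕ => 1 / qPoch q q n) atTop (𝓝 (1 / qPochInf q q)) :=
  Tendsto.div tendsto_const_nhds
    (multipliable_one_sub_pow_mul_self hq).tendsto_prod_tprod_nat (qPochInf_self_ne_zero hq)

theorem invPoch_of_neg {m : ℤ} (hm : m < 0) : invPoch q m = 0 := if_pos hm

theorem invPoch_natCast (n : ℕ) : invPoch q n = 1 / qPoch q q n := by
  simp [invPoch]

theorem invPoch_zero : invPoch q 0 = 1 := by simp [invPoch, qPoch]

/-- The extension by zero is consistent: at m = 0 the factor 1 - q^m vanishes, so the recurrence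
needs no sign condition on m. -/
theorem invPoch_sub_one (hq : ‖q‖ < 1) (m : ℤ) :
    invPoch q (m - 1) = (1 - q ^ m) * invPoch q m := by
  rcases lt_trichotomy m 0 with h | rfl | h
  · rw [invPoch_of_neg h, invPoch_of_neg (by lia), mul_zero]
  · rw [invPoch_of_neg (by lia), zpow_zero, sub_self, zero_mul]
  · obtain ⟨n, rfl⟩ : ∃ n : ℕ, m = n + 1 := ⟨(m - 1).toNat, by lia⟩
    have h1 : ((n : ℤ) + 1) = ((n + 1 : ℕ) : ℤ) := by push_cast; rfl
    rw [add_sub_cancel_right, h1, invPoch_natCast, invPoch_natCast, zpow_natCast, qPoch, qPoch,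
      Finset.prod_range_succ, pow_succ]
    have h2 := one_sub_pow_mul_self_ne_zero hq n
    rw [one_div, one_div, mul_inv, mul_left_comm, mul_inv_cancel₀ h2, mul_one]

/-- The `q`-Pascal rule, in a form symmetric in the two lower parameters. -/
theorem one_sub_zpow_add_mul_invPoch (hq0 : q ≠ 0) (hq : ‖q‖ < 1) (a b : ℤ) :
    (1 - q ^ (a + b)) * (invPoch q a * invPoch q b) =
      invPoch q a * invPoch q (b - 1) + q ^ b * (invPoch q (a - 1) * invPoch q b) := by
  rw [invPoch_sub_one hq, invPoch_sub_one hq, zpow_add₀ hq0]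
  ring

theorem exists_norm_invPoch_le (hq : ‖q‖ < 1) : ∃ C, ∀ m, ‖invPoch q m‖ ≤ C := by
  obtain ⟨C, hC⟩ := (tendsto_one_div_qPoch hq).norm.bddAbove_range
  refine ⟨max C 0, fun m => ?_⟩
  rcases lt_or_ge m 0 with h | h
  · simp [invPoch_of_neg h]
  · lift m to ℕ using h
    rw [invPoch_natCast]
    exact (hC ⟨m, rfl⟩).trans (le_max_left _ _)

theorem exists_norm_invPoch_mul_le (hq : ‖q‖ < 1) :
    ∃ C, ∀ a b, ‖invPoch q a * invPoch q b‖ ≤ C := by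
  obtain ⟨C, hC⟩ := exists_norm_invPoch_le hq
  refine ⟨C * C, fun a b => ?_⟩
  rw [norm_mul]
  exact mul_le_mul (hC a) (hC b) (norm_nonneg _) ((norm_nonneg _).trans (hC a))

end Basic

/-! ### Convergence of series with quadratic exponents -/

section Summability

theorem summable_pow_natAbs {r : ℝ} (h0 : 0 ≤ r) (h1 : r < 1) :
    Summable fun k : ℤ => r ^ k.natAbs :=
  Summable.of_nat_of_neg (by simpa using summable_geometric_of_lt_one h0 h1)
    (by simpa using summable_geometric_of_lt_one h0 h1)

theorem summable_zpow_quadratic {r : ℝ} (h0 : 0 < r) (h1 : r < 1) {a : ℤ} (b c : ℤ)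
    (ha : 0 < a) : Summable fun k : ℤ => r ^ (a * k ^ 2 + b * k + c) := by
  -- With B = |b| + 1, the bound k² - B|k| + B² ≥ 0 makes the exponent at least |k| + c - B².
  refine Summable.of_nonneg_of_le (fun k => (zpow_pos h0 _).le) (fun k => ?_)
    ((summable_pow_natAbs h0.le h1).mul_left (r ^ (c - (|b| + 1) ^ 2)))
  rw [← zpow_natCast, ← zpow_add₀ h0.ne', Int.natCast_natAbs]
  refine zpow_le_zpow_right_of_le_one₀ h0 h1.le ?_
  have hb : -(|b| * |k|) ≤ b * k := by rw [← abs_mul]; exact neg_abs_le _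
  have hk : k ^ 2 ≤ a * k ^ 2 := le_mul_of_one_le_left (sq_nonneg k) ha
  have hs := sq_abs k
  nlinarith [sq_nonneg (|k| - (|b| + 1)), sq_nonneg (|k|), sq_nonneg (|b| + 1)]

variable {q : ℂ}

theorem summable_norm_zpow_quadratic (hq0 : q ≠ 0) (hq : ‖q‖ < 1) {e : ℤ → ℤ} (a b c : ℤ)
    (ha : 0 < a) (he : ∀ k, e k = a * k ^ 2 + b * k + c) : Summable fun k : ℤ => ‖q ^ e k‖ := by
  simp only [he, norm_zpow]
  exact summable_zpow_quadratic (norm_pos_iff.mpr hq0) hq b c ha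

theorem summable_zpow_quadratic_mul_invPoch (hq0 : q ≠ 0) (hq : ‖q‖ < 1) {e : ℤ → ℤ}
    (a b c : ℤ) (ha : 0 < a) (he : ∀ k, e k = a * k ^ 2 + b * k + c) (f g : ℤ → ℤ) :
    Summable fun k : ℤ => q ^ e k * (invPoch q (f k) * invPoch q (g k)) := by
  obtain ⟨C, hC⟩ := exists_norm_invPoch_mul_le hq
  refine Summable.of_norm_bounded
    ((summable_norm_zpow_quadratic hq0 hq a b c ha he).mul_right C) fun k => ?_
  rw [norm_mul]
  exact mul_le_mul_of_nonneg_left (hC _ _) (norm_nonneg _)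

end Summability

/-! ### The finite expansions of 1/(q;q)_{2n} and 1/(q;q)_{2n+1} -/

section FiniteIdentity

variable {q : ℂ}

/-- The summand of the alternating sum whose total is `1 / (q; q)_{2n}`. -/
noncomputable def evenTerm (q : ℂ) (n k : ℤ) : ℂ :=
  q ^ (6 * k ^ 2 + k) * (invPoch q (n - 3 * k) * invPoch q (n + 3 * k)) -
    q ^ (6 * k ^ 2 + 5 * k + 1) * (invPoch q (n - 3 * k - 1) * invPoch q (n + 3 * k + 1))

/-- The summand of the alternating sum whose total is `1 / (q; q)_{2n+1}`. -/
noncomputable def oddTerm (q : ℂ) (n k : ℤ) : ℂ :=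
  q ^ (6 * k ^ 2 + k) * (invPoch q (n - 3 * k) * invPoch q (n + 3 * k + 1)) -
    q ^ (6 * k ^ 2 + 5 * k + 1) * (invPoch q (n - 3 * k - 1) * invPoch q (n + 3 * k + 2))

theorem summable_evenTerm (hq0 : q ≠ 0) (hq : ‖q‖ < 1) (n : ℤ) : Summable (evenTerm q n) :=
  (summable_zpow_quadratic_mul_invPoch hq0 hq 6 1 0 (by norm_num) (fun k => by ring) _ _).sub
    (summable_zpow_quadratic_mul_invPoch hq0 hq 6 5 1 (by norm_num) (fun k => by ring) _ _)

theorem summable_oddTerm (hq0 : q ≠ 0) (hq : ‖q‖ < 1) (n : ℤ) : Summable (oddTerm q n) :=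
  (summable_zpow_quadratic_mul_invPoch hq0 hq 6 1 0 (by norm_num) (fun k => by ring) _ _).sub
    (summable_zpow_quadratic_mul_invPoch hq0 hq 6 5 1 (by norm_num) (fun k => by ring) _ _)

theorem tsum_add_sub_comp_equiv {f g : ℤ → ℂ} (hf : Summable f) (hg : Summable g) (σ : ℤ ≃ ℤ) :
    ∑' k, (f k + (g k - g (σ k))) = ∑' k, f k := by
  have hσ : Summable fun k => g (σ k) := σ.summable_iff.mpr hg
  rw [hf.tsum_add (hg.sub hσ), hg.tsum_sub hσ, σ.tsum_eq g, sub_self, add_zero]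

/-- The q-Pascal rule turns each half of the odd summand into the matching half of the even summand
plus an extra term. The extra terms are X(k) and -X(-1-k), so they cancel in the sum over k. -/
theorem one_sub_mul_tsum_oddTerm (hq0 : q ≠ 0) (hq : ‖q‖ < 1) (n : ℤ) :
    (1 - q ^ (2 * n + 1)) * ∑' k, oddTerm q n k = ∑' k, evenTerm q n k := by
  let X : ℤ → ℂ := fun k => q ^ (6 * k ^ 2 + 4 * k + (n + 1)) *
    (invPoch q (n - 3 * k - 1) * invPoch q (n + 3 * k + 1))
  have hX : Summable X :=
    summable_zpow_quadratic_mul_invPoch hq0 hq 6 4 (n + 1) (by norm_num) (fun k => by ring) _ _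
  rw [← tsum_mul_left, ← tsum_add_sub_comp_equiv (summable_evenTerm hq0 hq n) hX
    (Equiv.subLeft (-1))]
  refine tsum_congr fun k => ?_
  have h1 := one_sub_zpow_add_mul_invPoch hq0 hq (n - 3 * k) (n + 3 * k + 1)
  have h2 := one_sub_zpow_add_mul_invPoch hq0 hq (n - 3 * k - 1) (n + 3 * k + 2)
  rw [show n - 3 * k + (n + 3 * k + 1) = 2 * n + 1 by ring,
    show n + 3 * k + 1 - 1 = n + 3 * k by ring] at h1
  rw [show n - 3 * k - 1 + (n + 3 * k + 2) = 2 * n + 1 by ring,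
    show n + 3 * k + 2 - 1 = n + 3 * k + 1 by ring,
    show n - 3 * k - 1 - 1 = n - 3 * k - 2 by ring] at h2
  have e1 : q ^ (6 * k ^ 2 + k) * q ^ (n + 3 * k + 1) = q ^ (6 * k ^ 2 + 4 * k + (n + 1)) := by
    rw [← zpow_add₀ hq0]; congr 1; ring
  have e2 : q ^ (6 * k ^ 2 + 5 * k + 1) * q ^ (n + 3 * k + 2) =
      q ^ (6 * (-1 - k) ^ 2 + 4 * (-1 - k) + (n + 1)) := by
    rw [← zpow_add₀ hq0]; congr 1; ring
  simp only [X, oddTerm, evenTerm, Equiv.subLeft_apply]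
  rw [← e1, ← e2, show n - 3 * (-1 - k) - 1 = n + 3 * k + 2 by ring,
    show n + 3 * (-1 - k) + 1 = n - 3 * k - 2 by ring]
  linear_combination q ^ (6 * k ^ 2 + k) * h1 - q ^ (6 * k ^ 2 + 5 * k + 1) * h2

/-- Here the q-Pascal rule is applied with its two arguments swapped, so that n - 3k is lowered in
the main term. The extra terms X(k) and -X(-k) cancel under k ↦ -k. -/
theorem one_sub_mul_tsum_evenTerm (hq0 : q ≠ 0) (hq : ‖q‖ < 1) (n : ℤ) :
    (1 - q ^ (2 * n)) * ∑' k, evenTerm q n k = ∑' k, oddTerm q (n - 1) k := by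
  let X : ℤ → ℂ := fun k => q ^ (6 * k ^ 2 + -2 * k + n) *
    (invPoch q (n - 3 * k) * invPoch q (n + 3 * k - 1))
  have hX : Summable X :=
    summable_zpow_quadratic_mul_invPoch hq0 hq 6 (-2) n (by norm_num) (fun k => by ring) _ _
  rw [← tsum_mul_left, ← tsum_add_sub_comp_equiv (summable_oddTerm hq0 hq (n - 1)) hX
    (Equiv.neg ℤ)]
  refine tsum_congr fun k => ?_
  have h1 := one_sub_zpow_add_mul_invPoch hq0 hq (n + 3 * k) (n - 3 * k)
  have h2 := one_sub_zpow_add_mul_invPoch hq0 hq (n + 3 * k + 1) (n - 3 * k - 1)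
  rw [show n + 3 * k + (n - 3 * k) = 2 * n by ring] at h1
  rw [show n + 3 * k + 1 + (n - 3 * k - 1) = 2 * n by ring,
    show n + 3 * k + 1 - 1 = n + 3 * k by ring,
    show n - 3 * k - 1 - 1 = n - 3 * k - 2 by ring] at h2
  have e1 : q ^ (6 * k ^ 2 + k) * q ^ (n - 3 * k) = q ^ (6 * k ^ 2 + -2 * k + n) := by
    rw [← zpow_add₀ hq0]; congr 1; ring
  have e2 : q ^ (6 * k ^ 2 + 5 * k + 1) * q ^ (n - 3 * k - 1) =
      q ^ (6 * (-k) ^ 2 + -2 * (-k) + n) := by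
    rw [← zpow_add₀ hq0]; congr 1; ring
  simp only [X, oddTerm, evenTerm, Equiv.neg_apply]
  rw [← e1, ← e2, show n - 3 * (-k) = n + 3 * k by ring,
    show n + 3 * (-k) - 1 = n - 3 * k - 1 by ring,
    show n - 1 - 3 * k = n - 3 * k - 1 by ring,
    show n - 3 * k - 1 - 1 = n - 3 * k - 2 by ring,
    show n - 1 + 3 * k + 1 = n + 3 * k by ring,
    show n - 1 + 3 * k + 2 = n + 3 * k + 1 by ring]
  linear_combination q ^ (6 * k ^ 2 + k) * h1 - q ^ (6 * k ^ 2 + 5 * k + 1) * h2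

theorem invPoch_mul_eq_zero {a b : ℤ} (h : a < 0 ∨ b < 0) : invPoch q a * invPoch q b = 0 := by
  rcases h with h | h <;> simp [invPoch_of_neg h]

theorem tsum_evenTerm_zero : ∑' k, evenTerm q 0 k = 1 := by
  rw [tsum_eq_single 0]
  · simp [evenTerm, invPoch_zero, invPoch_of_neg]
  · intro k hk
    rw [evenTerm, invPoch_mul_eq_zero (by lia), invPoch_mul_eq_zero (by lia)]
    simp

theorem one_sub_zpow_ne_zero (hq : ‖q‖ < 1) {m : ℤ} (hm : 0 < m) : 1 - q ^ m ≠ 0 := by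
  obtain ⟨n, rfl⟩ : ∃ n : ℕ, m = ((n + 1 : ℕ) : ℤ) := ⟨(m - 1).toNat, by lia⟩
  rw [zpow_natCast, pow_succ]
  exact one_sub_pow_mul_self_ne_zero hq n

theorem tsum_oddTerm_of_even (hq0 : q ≠ 0) (hq : ‖q‖ < 1) (n : ℕ)
    (h : ∑' k, evenTerm q n k = invPoch q (2 * n)) :
    ∑' k, oddTerm q n k = invPoch q (2 * n + 1) := by
  have h1 := one_sub_mul_tsum_oddTerm hq0 hq n
  have h2 := invPoch_sub_one hq (2 * n + 1)
  rw [add_sub_cancel_right] at h2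
  rw [h, h2] at h1
  exact mul_left_cancel₀ (one_sub_zpow_ne_zero hq (by lia)) h1

theorem tsum_evenTerm_natCast (hq0 : q ≠ 0) (hq : ‖q‖ < 1) (n : ℕ) :
    ∑' k, evenTerm q n k = invPoch q (2 * n) := by
  induction n with
  | zero => simpa [invPoch_zero] using tsum_evenTerm_zero
  | succ n ih =>
    have h1 := one_sub_mul_tsum_evenTerm hq0 hq (n + 1)
    rw [add_sub_cancel_right, tsum_oddTerm_of_even hq0 hq n ih,
      show (2 * n + 1 : ℤ) = 2 * (n + 1) - 1 by ring, invPoch_sub_one hq] at h1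
    push_cast
    exact mul_left_cancel₀ (one_sub_zpow_ne_zero hq (by lia)) h1

theorem tsum_oddTerm (hq0 : q ≠ 0) (hq : ‖q‖ < 1) (n : ℤ) :
    ∑' k, oddTerm q n k = invPoch q (2 * n + 1) := by
  rcases lt_or_ge n 0 with h | h
  · rw [invPoch_of_neg (by lia)]
    refine (tsum_congr fun k => ?_).trans tsum_zero
    -- In each product the two indices add up to 2n + 1 < 0, so one of them is negative.
    rw [oddTerm, invPoch_mul_eq_zero (by lia), invPoch_mul_eq_zero (by lia)]
    simp
  · lift n to ℕ using h
    exact tsum_oddTerm_of_even hq0 hq n (tsum_evenTerm_natCast hq0 hq n)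

end FiniteIdentity

/-! ### The Durfee rectangle identity -/

section Durfee

variable {q : ℂ}

/-- The sum over Durfee rectangles of width excess `s`. -/
noncomputable def durfeeSum (q : ℂ) (s : ℤ) : ℂ :=
  ∑' m : ℤ, q ^ (m ^ 2 + s * m) * (invPoch q m * invPoch q (m + s))

/-- Termwise the two sides differ by X(m+1) - X(m), which sums to zero over the integers. -/
theorem durfeeSum_sub_succ (hq0 : q ≠ 0) (hq : ‖q‖ < 1) (s : ℤ) :
    durfeeSum q s - durfeeSum q (s + 1) =
      -q ^ (s + 1) * (durfeeSum q (s + 1) - durfeeSum q (s + 2)) := by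
  have hF (s : ℤ) : Summable fun m : ℤ =>
      q ^ (m ^ 2 + s * m) * (invPoch q m * invPoch q (m + s)) :=
    summable_zpow_quadratic_mul_invPoch hq0 hq 1 s 0 (by norm_num) (fun k => by ring) _ _
  let X : ℤ → ℂ := fun m => q ^ (m ^ 2 + s * m) * (invPoch q (m - 1) * invPoch q (m + s + 1))
  have hX : Summable X :=
    summable_zpow_quadratic_mul_invPoch hq0 hq 1 s 0 (by norm_num) (fun k => by ring) _ _
  have key : ∑' m : ℤ, ((q ^ (m ^ 2 + s * m) * (invPoch q m * invPoch q (m + s)) -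
      q ^ (m ^ 2 + (s + 1) * m) * (invPoch q m * invPoch q (m + (s + 1)))) +
      (X (Equiv.addRight 1 m) - X m)) = ∑' m : ℤ, (-q ^ (s + 1) *
      (q ^ (m ^ 2 + (s + 1) * m) * (invPoch q m * invPoch q (m + (s + 1))) -
        q ^ (m ^ 2 + (s + 2) * m) * (invPoch q m * invPoch q (m + (s + 2))))) := by
    refine tsum_congr fun m => ?_
    have h0 := invPoch_sub_one hq m
    have h1 := invPoch_sub_one hq (m + s + 1)
    have h2 := invPoch_sub_one hq (m + s + 2)
    rw [show m + s + 1 - 1 = m + s by ring] at h1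
    rw [show m + s + 2 - 1 = m + s + 1 by ring] at h2
    simp only [X, Equiv.coe_addRight, add_sub_cancel_right]
    rw [show m + 1 + s + 1 = m + s + 2 by ring, show m + (s + 1) = m + s + 1 by ring,
      show m + (s + 2) = m + s + 2 by ring, h0, h1, h2,
      show (m + 1) ^ 2 + s * (m + 1) = (m ^ 2 + s * m) + m + m + s + 1 by ring,
      show m ^ 2 + (s + 1) * m = (m ^ 2 + s * m) + m by ring,
      show m ^ 2 + (s + 2) * m = (m ^ 2 + s * m) + m + m by ring,
      show m + s + 2 = m + s + 1 + 1 by ring]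
    simp only [zpow_add₀ hq0, zpow_one]
    ring
  have hXσ : Summable fun m => X (Equiv.addRight 1 m) :=
    (Equiv.addRight (1 : ℤ)).summable_iff.mpr hX
  rw [((hF s).sub (hF (s + 1))).tsum_add (hXσ.sub hX), (hF s).tsum_sub (hF (s + 1)),
    hXσ.tsum_sub hX, Equiv.tsum_eq (Equiv.addRight (1 : ℤ)) X, tsum_mul_left,
    (hF (s + 1)).tsum_sub (hF (s + 2)), sub_self, add_zero] at key
  exact key

theorem tendsto_invPoch_add (hq : ‖q‖ < 1) (s : ℤ) :
    Tendsto (fun j : ℕ => invPoch q (s + j)) atTop (𝓝 (1 / qPochInf q q)) := by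
  have h : Tendsto (fun j : ℕ => (s + j).toNat) atTop atTop := by
    refine tendsto_atTop.mpr fun b => ?_
    filter_upwards [eventually_ge_atTop (b + s.natAbs)] with j hj
    lia
  refine ((tendsto_one_div_qPoch hq).comp h).congr' ?_
  filter_upwards [eventually_ge_atTop s.natAbs] with j hj
  rw [invPoch, if_neg (by lia)]
  rfl

/-- Terms with m < 0 vanish and those with m > 0 carry a factor q^(jm) tending to 0, so by dominated
convergence only m = 0 contributes in the limit. -/
theorem tendsto_durfeeSum (hq0 : q ≠ 0) (hq : ‖q‖ < 1) (s : ℤ) :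
    Tendsto (fun j : ℕ => durfeeSum q (s + j)) atTop (𝓝 (1 / qPochInf q q)) := by
  obtain ⟨C, hC⟩ := exists_norm_invPoch_mul_le hq
  have hlim : ∑' m : ℤ, (if m = 0 then 1 / qPochInf q q else 0) = 1 / qPochInf q q :=
    tsum_ite_eq 0 _
  rw [← hlim]
  have hC0 : 0 ≤ C := (norm_nonneg _).trans (hC 0 0)
  refine tendsto_tsum_of_dominated_convergence (bound := fun m : ℤ => ‖q ^ (m ^ 2 + s * m)‖ * C)
    ((summable_norm_zpow_quadratic hq0 hq 1 s 0 (by norm_num) (fun k => by ring)).mul_right C)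
    (fun m => ?_) (Eventually.of_forall fun j m => ?_)
  · rcases lt_trichotomy m 0 with h | rfl | h
    · simp [invPoch_of_neg h, h.ne]
    · simpa [invPoch_zero] using tendsto_invPoch_add hq s
    · rw [if_neg h.ne']
      have hz : Tendsto (fun j : ℕ => ‖q ^ (m ^ 2 + s * m)‖ * C * ‖q‖ ^ j) atTop (𝓝 0) := by
        simpa using (tendsto_pow_atTop_nhds_zero_of_lt_one (norm_nonneg q) hq).const_mul
          (‖q ^ (m ^ 2 + s * m)‖ * C)
      refine squeeze_zero_norm (fun j => ?_) hz
      have hle : ‖q ^ ((j : ℤ) * m)‖ ≤ ‖q‖ ^ j := by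
        rw [norm_zpow, ← zpow_natCast]
        exact zpow_le_zpow_right_of_le_one₀ (norm_pos_iff.mpr hq0) hq.le (by nlinarith)
      rw [show m ^ 2 + (s + j) * m = (m ^ 2 + s * m) + j * m by ring, zpow_add₀ hq0, norm_mul,
        norm_mul, mul_assoc, mul_assoc, mul_comm C]
      gcongr
      exact hC _ _
  · rcases lt_or_ge m 0 with h | h
    · rw [invPoch_of_neg h]
      simpa using mul_nonneg (norm_nonneg (q ^ (m ^ 2 + s * m))) hC0
    · rw [norm_mul]
      refine mul_le_mul ?_ (hC _ _) (norm_nonneg _) (norm_nonneg _)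
      rw [norm_zpow, norm_zpow]
      exact zpow_le_zpow_right_of_le_one₀ (norm_pos_iff.mpr hq0) hq.le (by nlinarith)

/-- By the recurrence, the norm of the difference of consecutive sums does not decrease as s grows,
since |q^(s+1)| ≤ 1. It also tends to 0, so it is 0 from the start. -/
theorem durfeeSum_succ (hq0 : q ≠ 0) (hq : ‖q‖ < 1) {s : ℤ} (hs : 0 ≤ s) :
    durfeeSum q s = durfeeSum q (s + 1) := by
  have hbound (j : ℕ) : ‖durfeeSum q s - durfeeSum q (s + 1)‖ ≤
      ‖durfeeSum q (s + j) - durfeeSum q (s + 1 + j)‖ := by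
    induction j with
    | zero => simp
    | succ j ih =>
      refine ih.trans ?_
      rw [show s + 1 + (j : ℤ) = s + j + 1 by ring, durfeeSum_sub_succ hq0 hq, norm_mul, norm_neg,
        show s + ((j + 1 : ℕ) : ℤ) = s + j + 1 by push_cast; ring,
        show s + 1 + ((j + 1 : ℕ) : ℤ) = s + j + 2 by push_cast; ring]
      refine mul_le_of_le_one_left (norm_nonneg _) ?_
      rw [norm_zpow]
      exact zpow_le_one₀ (norm_pos_iff.mpr hq0) hq.le (by lia)
  have hz : Tendsto (fun j : ℕ => ‖durfeeSum q (s + j) - durfeeSum q (s + 1 + j)‖) atTop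
      (𝓝 0) := by
    simpa using ((tendsto_durfeeSum hq0 hq s).sub (tendsto_durfeeSum hq0 hq (s + 1))).norm
  exact sub_eq_zero.mp (norm_le_zero_iff.mp (ge_of_tendsto' hz hbound))

theorem durfeeSum_neg (s : ℤ) : durfeeSum q (-s) = durfeeSum q s := by
  rw [durfeeSum, ← (Equiv.addRight s).tsum_eq]
  refine tsum_congr fun m => ?_
  simp only [Equiv.coe_addRight, add_neg_cancel_right]
  rw [mul_comm (invPoch q m), show (m + s) ^ 2 + -s * (m + s) = m ^ 2 + s * m by ring]

theorem durfeeSum_eq (hq0 : q ≠ 0) (hq : ‖q‖ < 1) (s : ℤ) :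
    durfeeSum q s = 1 / qPochInf q q := by
  have main {s : ℤ} (hs : 0 ≤ s) : durfeeSum q s = 1 / qPochInf q q := by
    have hconst (j : ℕ) : durfeeSum q (s + j) = durfeeSum q s := by
      induction j with
      | zero => simp
      | succ j ih => rw [← ih, durfeeSum_succ hq0 hq (by lia : 0 ≤ s + j)]; congr 1; push_cast; ring
    refine tendsto_nhds_unique ?_ (tendsto_durfeeSum hq0 hq s)
    simp only [hconst]
    exact tendsto_const_nhds
  rcases le_total 0 s with h | h
  · exact main h
  · rw [← durfeeSum_neg]
    exact main (by lia)

/-- Putting n = m + r gives a Durfee sum of excess 2r + 1, which is negative for r < 0; hence the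
need for `durfeeSum_neg`. -/
theorem tsum_zpow_mul_invPoch (hq0 : q ≠ 0) (hq : ‖q‖ < 1) (r : ℤ) :
    ∑' n : ℤ, q ^ (n ^ 2 + n) * (invPoch q (n - r) * invPoch q (n + r + 1)) =
      q ^ (r ^ 2 + r) * (1 / qPochInf q q) := by
  rw [← durfeeSum_eq hq0 hq (2 * r + 1), durfeeSum, ← tsum_mul_left,
    ← (Equiv.addRight r).tsum_eq]
  refine tsum_congr fun m => ?_
  simp only [Equiv.coe_addRight, add_sub_cancel_right]
  rw [← mul_assoc (q ^ (r ^ 2 + r)), ← zpow_add₀ hq0, show m + r + r + 1 = m + (2 * r + 1) by ring,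
    show (m + r) ^ 2 + (m + r) = r ^ 2 + r + (m ^ 2 + (2 * r + 1) * m) by ring]

end Durfee

/-! ### Exchange of summations and the final identity -/

section Main

variable {q : ℂ}

theorem summable_prod_zpow_mul_invPoch (hq0 : q ≠ 0) (hq : ‖q‖ < 1) {e : ℤ → ℤ} (a b c : ℤ)
    (ha : 0 < a) (he : ∀ k, e k = a * k ^ 2 + b * k + c) (f g : ℤ → ℤ → ℤ) :
    Summable (Function.uncurry fun n k : ℤ =>
      q ^ (n ^ 2 + n) * (q ^ e k * (invPoch q (f n k) * invPoch q (g n k)))) := by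
  obtain ⟨C, hC⟩ := exists_norm_invPoch_mul_le hq
  have h1 := summable_norm_zpow_quadratic (e := fun n => n ^ 2 + n) hq0 hq 1 1 0 (by norm_num)
    (fun k => by ring)
  have h2 := summable_norm_zpow_quadratic hq0 hq a b c ha he
  refine Summable.of_norm_bounded ((h1.mul_of_nonneg h2 (fun _ => norm_nonneg _)
    (fun _ => norm_nonneg _)).mul_right C) fun p => ?_
  rw [Function.uncurry, norm_mul, norm_mul, ← mul_assoc]
  exact mul_le_mul_of_nonneg_left (hC _ _) (by positivity)

theorem tsum_int_zpow_mul_invPoch (hq0 : q ≠ 0) (hq : ‖q‖ < 1) :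
    ∑' n : ℤ, q ^ (n ^ 2 + n) * invPoch q (2 * n + 1) =
      1 / qPochInf q q *
        ∑' k : ℤ, (q ^ (15 * k ^ 2 - 4 * k) - q ^ (15 * k ^ 2 + 14 * k + 3)) := by
  have h1 := summable_prod_zpow_mul_invPoch (e := fun k => 6 * k ^ 2 + k) hq0 hq 6 1 0
    (by norm_num) (fun k => by ring) (fun n k => n - 3 * k) (fun n k => n + 3 * k + 1)
  have h2 := summable_prod_zpow_mul_invPoch (e := fun k => 6 * k ^ 2 + 5 * k + 1) hq0 hq 6 5 1
    (by norm_num) (fun k => by ring) (fun n k => n - 3 * k - 1) (fun n k => n + 3 * k + 2)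
  have hsum : Summable (Function.uncurry fun n k : ℤ => q ^ (n ^ 2 + n) * oddTerm q n k) := by
    refine (h1.sub h2).congr fun p => ?_
    simp only [Function.uncurry, oddTerm]
    ring
  have s1 : Summable fun k : ℤ => q ^ (15 * k ^ 2 - 4 * k) :=
    (summable_norm_zpow_quadratic hq0 hq 15 (-4) 0 (by norm_num) fun k => by ring).of_norm
  have s1' : Summable fun k : ℤ => q ^ (15 * k ^ 2 + 4 * k) :=
    (summable_norm_zpow_quadratic hq0 hq 15 4 0 (by norm_num) fun k => by ring).of_norm
  have s2 : Summable fun k : ℤ => q ^ (15 * k ^ 2 + 14 * k + 3) :=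
    (summable_norm_zpow_quadratic hq0 hq 15 14 3 (by norm_num) fun k => by ring).of_norm
  -- The exchange produces 15k² + 4k; reflecting k gives the stated 15k² - 4k.
  have hflip : ∑' k : ℤ, q ^ (15 * k ^ 2 - 4 * k) = ∑' k : ℤ, q ^ (15 * k ^ 2 + 4 * k) := by
    rw [← (Equiv.neg ℤ).tsum_eq]
    refine tsum_congr fun k => ?_
    rw [Equiv.neg_apply]
    congr 1
    ring
  calc ∑' n : ℤ, q ^ (n ^ 2 + n) * invPoch q (2 * n + 1)
      = ∑' n : ℤ, ∑' k : ℤ, q ^ (n ^ 2 + n) * oddTerm q n k :=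
        tsum_congr fun n => by rw [tsum_mul_left, tsum_oddTerm hq0 hq]
    _ = ∑' k : ℤ, ∑' n : ℤ, q ^ (n ^ 2 + n) * oddTerm q n k := hsum.tsum_comm.symm
    _ = ∑' k : ℤ, 1 / qPochInf q q *
          (q ^ (15 * k ^ 2 + 4 * k) - q ^ (15 * k ^ 2 + 14 * k + 3)) := by
        refine tsum_congr fun k => ?_
        have t1 := tsum_zpow_mul_invPoch hq0 hq (3 * k)
        have t2 := tsum_zpow_mul_invPoch hq0 hq (3 * k + 1)
        have u (r : ℤ) : Summable fun n : ℤ =>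
            q ^ (n ^ 2 + n) * (invPoch q (n - r) * invPoch q (n + r + 1)) :=
          summable_zpow_quadratic_mul_invPoch hq0 hq 1 1 0 (by norm_num) (fun k => by ring) _ _
        have e1 : q ^ (6 * k ^ 2 + k) * q ^ ((3 * k) ^ 2 + 3 * k) = q ^ (15 * k ^ 2 + 4 * k) := by
          rw [← zpow_add₀ hq0]; congr 1; ring
        have e2 : q ^ (6 * k ^ 2 + 5 * k + 1) * q ^ ((3 * k + 1) ^ 2 + (3 * k + 1)) =
            q ^ (15 * k ^ 2 + 14 * k + 3) := by
          rw [← zpow_add₀ hq0]; congr 1; ring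
        have hterm (n : ℤ) : q ^ (n ^ 2 + n) * oddTerm q n k =
            q ^ (6 * k ^ 2 + k) * (q ^ (n ^ 2 + n) *
              (invPoch q (n - 3 * k) * invPoch q (n + 3 * k + 1))) -
            q ^ (6 * k ^ 2 + 5 * k + 1) * (q ^ (n ^ 2 + n) *
              (invPoch q (n - (3 * k + 1)) * invPoch q (n + (3 * k + 1) + 1))) := by
          rw [oddTerm, show n - (3 * k + 1) = n - 3 * k - 1 by ring,
            show n + (3 * k + 1) + 1 = n + 3 * k + 2 by ring]
          ring
        rw [tsum_congr hterm, ((u (3 * k)).mul_left _).tsum_sub ((u (3 * k + 1)).mul_left _),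
          tsum_mul_left, tsum_mul_left, t1, t2, ← e1, ← e2]
        ring
    _ = _ := by rw [tsum_mul_left, s1'.tsum_sub s2, s1.tsum_sub s2, hflip]

theorem zpow_mul_invPoch_natCast (n : ℕ) :
    q ^ ((n : ℤ) ^ 2 + n) * invPoch q (2 * n + 1) = q ^ (n ^ 2 + n) / qPoch q q (2 * n + 1) := by
  rw [show ((n : ℤ) ^ 2 + n) = ((n ^ 2 + n : ℕ) : ℤ) by push_cast; rfl,
    show (2 * (n : ℤ) + 1) = ((2 * n + 1 : ℕ) : ℤ) by push_cast; rfl, zpow_natCast,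
    invPoch_natCast, mul_one_div]

end Main

theorem corollary5p2 (q : ℂ) (hq : ‖q‖ < 1) :
    Summable (fun n : ℕ => q ^ (n ^ 2 + n) / qPoch q q (2 * n + 1)) ∧
    Multipliable (fun j : ℕ => 1 - q ^ j * q) ∧
    qPochInf q q ≠ 0 ∧
    Summable (fun k : ℤ => q ^ (15 * k ^ 2 - 4 * k) - q ^ (15 * k ^ 2 + 14 * k + 3)) ∧
    ∑' n : ℕ, q ^ (n ^ 2 + n) / qPoch q q (2 * n + 1) =
      1 / qPochInf q q *
        ∑' k : ℤ, (q ^ (15 * k ^ 2 - 4 * k) - q ^ (15 * k ^ 2 + 14 * k + 3)) := by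
  -- At q = 0 the exponent laws for `zpow` fail, but only the index 0 contributes and both sides
  -- equal 1.
  rcases eq_or_ne q 0 with rfl | hq0
  · have hL (n : ℕ) (hn : n ≠ 0) :
        (0 : ℂ) ^ (n ^ 2 + n) / qPoch 0 0 (2 * n + 1) = 0 := by
      rw [zero_pow (by positivity), zero_div]
    have hR (k : ℤ) (hk : k ≠ 0) :
        (0 : ℂ) ^ (15 * k ^ 2 - 4 * k) - 0 ^ (15 * k ^ 2 + 14 * k + 3) = 0 := by
      rcases lt_or_gt_of_ne hk with h | h <;>
        rw [zero_zpow _ (by nlinarith), zero_zpow _ (by nlinarith), sub_zero]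
    refine ⟨(hasSum_single 0 hL).summable, multipliable_one_sub_pow_mul_self hq,
      qPochInf_self_ne_zero hq, (hasSum_single 0 hR).summable, ?_⟩
    rw [tsum_eq_single 0 hL, tsum_eq_single 0 hR]
    simp [qPoch, qPochInf]
  · have hinj : Function.Injective (Nat.cast : ℕ → ℤ) := Nat.cast_injective
    have hsum : Summable fun n : ℤ => q ^ (n ^ 2 + n) * invPoch q (2 * n + 1) := by
      -- The constant index 0 makes the second reciprocal factor equal to 1.
      simpa [invPoch_zero] using summable_zpow_quadratic_mul_invPoch
        (e := fun n => n ^ 2 + n) hq0 hq 1 1 0 (by norm_num) (fun k => by ring)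
        (fun n => 2 * n + 1) (fun _ => 0)
    refine ⟨(hsum.comp_injective hinj).congr zpow_mul_invPoch_natCast,
      multipliable_one_sub_pow_mul_self hq, qPochInf_self_ne_zero hq,
      (summable_norm_zpow_quadratic hq0 hq 15 (-4) 0 (by norm_num) fun k => by ring).of_norm.sub
      (summable_norm_zpow_quadratic hq0 hq 15 14 3 (by norm_num) fun k => by ring).of_norm, ?_⟩
    rw [← tsum_int_zpow_mul_invPoch hq0 hq, ← tsum_congr zpow_mul_invPoch_natCast]
    -- For n < 0 the index 2n + 1 is negative, so the integer sum is supported on the naturals.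
    refine hinj.tsum_eq (f := fun n : ℤ => q ^ (n ^ 2 + n) * invPoch q (2 * n + 1)) ?_
    intro n hn
    rcases lt_or_ge n 0 with h | h
    · exact absurd (by simp [invPoch_of_neg (show 2 * n + 1 < 0 by lia)]) hn
    · exact ⟨n.toNat, Int.toNat_of_nonneg h⟩
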